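/- Let $X_1,\dots,X_N$ be independent random variables, where $X_i$ takes values in a finite set $L_i$; put $p_{i,j}=\mathbb{P}[X_i=j]$ for $j\in L_i$, and let $(\Omega,\mathbb{P})$ with $\Omega=L_1\times\dots\times L_N$ be the corresponding product probability space. Let $\mathcal{X}=\{(i,j): 1\le i\le N,\ j\in L_i\}$ and let $\mathcal{A}$ be the family of all *atomic events*, i.e. sets $Y\subseteq\mathcal{X}$ such that $(i,j),(i,j')\in Y$ implies $j=j'$. Write $Y\sim i$ if $(i,j)\in Y$ for some $j\in L_i$. For $\omega=(j_1,\dots,j_N)\in\Omega$ let $A_\omega=\{(1,j_1),\dots,(N,j_N)\}\in\mathcal{A}$. A function $Q\colon\mathcal{A}\to[0,1]$ is a *fractional hitting set* for an event $\mathcal{E}\subseteq\Omega$ if for every $\omega\in\mathcal{E}$ we have $Q(\emptyset)=0$ and $\sum_{Y\subseteq A_\omega}Q(Y)\ge 1$. For $\lambda\colon\mathcal{X}\to[0,\infty)$ and $i\in\{1,\dots,N\}$ let $$\Gamma(Q,\lambda)=\sum_{Y\in\mathcal{A}}Q(Y)\prod_{(i',j)\in Y}\lambda_{i',j},\qquad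 \Gamma_i(Q,\lambda)=\sum_{Y\in\mathcal{A}:\,Y\sim i}Q(Y)\prod_{(i',j)\in Y}\lambda_{i',j}.$$ **Corollary 4.6.** Let $\mathcal{E}_1,\dots,\mathcal{E}_K\subseteq\Omega$ be (bad) events, let $\kappa\in(0,1)$, and let $\lambda_{i,j}=(1+\kappa)p_{i,j}$ for all $(i,j)\in\mathcal{X}$. Suppose there are fractional hitting sets $Q_1,\dots,Q_K$ for $\mathcal{E}_1,\dots,\mathcal{E}_K$, respectively, such that 1. $\Gamma(Q_k,\lambda)<1$ for all $k\in\{1,\dots,K\}$; 2. $\displaystyle\sum_{k=1}^K\frac{\Gamma_i(Q_k,\lambda)}{1-\Gamma(Q_k,\lambda)}\le\frac{\kappa}{2}$ for all $i\in\{1,\dots,N\}$. Then $$\mathbb{P}\Big[\bigcap_{k=1}^K\overline{\mathcal{E}_k}\Big]\ge\frac{\kappa}{3}(1+\kappa)^{-N}.$$ -/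

import Mathlib

open MeasureTheory

namespace PartialResampling

variable {N : ℕ} (L : Fin N → Type*)

/-- Elements: pairs `(i, j)` with `i` a variable index and `j ∈ L i` a value of that variable. -/
abbrev Element := Σ i, L i

/-- Atomic events: sets of elements that contain at most one element `(i, j)` for each `i`. -/
def AtomicEvent :=
  {Y : Finset (Element L) //
    ∀ (i : Fin N) (j j' : L i), (⟨i, j⟩ : Element L) ∈ Y → (⟨i, j'⟩ : Element L) ∈ Y → j = j'}

noncomputable instance [∀ i, Fintype (L i)] : Fintype (AtomicEvent L) :=
  @Fintype.ofFinite _ (inferInstanceAs (Finite {Y : Finset (Element L) //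
    ∀ (i : Fin N) (j j' : L i), (⟨i, j⟩ : Element L) ∈ Y → (⟨i, j'⟩ : Element L) ∈ Y → j = j'}))

variable {L}

/-- The empty atomic event. -/
def AtomicEvent.empty : AtomicEvent L :=
  ⟨∅, fun _ _ _ h => absurd h (Finset.notMem_empty _)⟩

/-- `Y ∼ i`: the atomic event `Y` contains an element `(i, j)` for some `j`. -/
def AtomicEvent.Involves (Y : AtomicEvent L) (i : Fin N) : Prop :=
  ∃ j : L i, (⟨i, j⟩ : Element L) ∈ Y.1

/-- The assignment `A_ω = {(1, ω₁), …, (N, ω_N)}` of a point `ω` of the product space. -/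
def assignmentOf (ω : ∀ i, L i) : AtomicEvent L :=
  ⟨Finset.univ.map ⟨fun i => (⟨i, ω i⟩ : Element L), fun _ _ h => congrArg Sigma.fst h⟩, by
    intro i j j' h h'
    simp only [Finset.mem_map, Finset.mem_univ, Function.Embedding.coeFn_mk, true_and] at h h'
    obtain ⟨a, ha⟩ := h
    obtain ⟨b, hb⟩ := h'
    cases ha
    cases hb
    rfl⟩

/-- The complex event `{A_ω : ω ∈ E}` of an event `E` in the product space. -/
def complexEventOf (E : Set (∀ i, L i)) : Set (AtomicEvent L) :=
  assignmentOf '' E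

variable [∀ i, Fintype (L i)]

open Classical in
/-- `Q` is a fractional hitting set for the atomic event `B`: `Q(∅) = 0` and
`∑_{Y ⊆ B} Q(Y) ≥ 1`. -/
def IsFractionalHittingSetFor (Q : AtomicEvent L → unitInterval) (B : AtomicEvent L) : Prop :=
  Q AtomicEvent.empty = 0 ∧
    1 ≤ ∑ Y ∈ Finset.univ.filter (fun Y : AtomicEvent L => Y.1 ⊆ B.1), (Q Y : ℝ)

/-- `Q` is a fractional hitting set for the complex event `𝓑`. -/
def IsFractionalHittingSetForComplex (Q : AtomicEvent L → unitInterval)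
    (𝓑 : Set (AtomicEvent L)) : Prop :=
  ∀ B ∈ 𝓑, IsFractionalHittingSetFor Q B

/-- `Q` is a fractional hitting set for the event `E` in the product space. -/
def IsFractionalHittingSet (Q : AtomicEvent L → unitInterval) (E : Set (∀ i, L i)) : Prop :=
  IsFractionalHittingSetForComplex Q (complexEventOf E)

/-- `Γ(Q, lam) = ∑_Y Q(Y) lam^Y`, where `lam^Y = ∏_{(i,j) ∈ Y} lam_{i,j}`. -/
noncomputable def Gam (Q : AtomicEvent L → unitInterval) (lam : Element L → ℝ) : ℝ :=
  ∑ Y : AtomicEvent L, (Q Y : ℝ) * ∏ e ∈ Y.1, lam e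

open Classical in
/-- `Γ_i(Q, lam) = ∑_{Y ∼ i} Q(Y) lam^Y`. -/
noncomputable def GamAt (Q : AtomicEvent L → unitInterval) (lam : Element L → ℝ)
    (i : Fin N) : ℝ :=
  ∑ Y ∈ Finset.univ.filter (fun Y : AtomicEvent L => Y.Involves i),
    (Q Y : ℝ) * ∏ e ∈ Y.1, lam e

end PartialResampling

/-! Relax the indicator of avoiding all bad events and reveal the coordinates one at a time. For a
set S of revealed coordinates, `slack` multiplies over k the quantity 1 minus the Q_k-weight of the
occurring atomic events supported in S, cut off at 0. It is 1 for S = ∅. For S everything it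
vanishes on every bad event, so its expectation is at most the avoidance probability. It thus
suffices that revealing a coordinate costs a factor at most 1 + κ.

Two estimates support each other. (A) `expect_occurs_mul_slack_le`: weighting the slack by the
occurrence of Z multiplies its expectation by at most λ^Z, as if occurrences were independent with
probabilities inflated by 1 + κ. (B) `expect_slack_le_insert`: (A) at S bounds the cost of revealing
one coordinate beyond S. Conversely, (A) at S uses (A) and (B) at proper subsets of S, so strong
induction on S closes the loop. -/

namespace PartialResampling

/-! ### Occurrence indicators and expectation under a finite product distribution -/

section Expectation

variable {N : ℕ} {L : Fin N → Type*}

open scoped Classical in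
/-- The indicator that every element of `Z` agrees with `ω`. -/
noncomputable def occurs (Z : Finset (Element L)) (ω : ∀ i, L i) : ℝ :=
  if ∀ e ∈ Z, ω e.1 = e.2 then 1 else 0

theorem occurs_nonneg (Z : Finset (Element L)) (ω : ∀ i, L i) : 0 ≤ occurs Z ω := by
  unfold occurs; split_ifs <;> norm_num

theorem weight_term_nonneg (q : AtomicEvent L → unitInterval) (ω : ∀ i, L i)
    (Y : AtomicEvent L) : 0 ≤ (q Y : ℝ) * occurs Y.1 ω :=
  mul_nonneg (q Y).2.1 (occurs_nonneg _ _)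

theorem occurs_empty (ω : ∀ i, L i) : occurs (∅ : Finset (Element L)) ω = 1 := by
  simp [occurs]

open scoped Classical in
theorem occurs_union (Y Z : Finset (Element L)) (ω : ∀ i, L i) :
    occurs (Y ∪ Z) ω = occurs Y ω * occurs Z ω := by
  have h : (∀ e ∈ Y ∪ Z, ω e.1 = e.2) ↔ (∀ e ∈ Y, ω e.1 = e.2) ∧ ∀ e ∈ Z, ω e.1 = e.2 := by
    simp only [Finset.mem_union, or_imp, forall_and]
  unfold occurs
  rw [if_congr h rfl rfl, ite_and]
  split_ifs <;> norm_num

open scoped Classical in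
theorem occurs_insert (e : Element L) (Z : Finset (Element L)) (ω : ∀ i, L i) :
    occurs (insert e Z) ω = occurs {e} ω * occurs Z ω := by
  rw [Finset.insert_eq, occurs_union]

theorem occurs_update {Z : Finset (Element L)} {i : Fin N} (hZ : ∀ e ∈ Z, e.1 ≠ i)
    (ω : ∀ i, L i) (x : L i) : occurs Z (Function.update ω i x) = occurs Z ω := by
  classical
  unfold occurs
  refine if_congr (forall₂_congr fun e he => ?_) rfl rfl
  rw [Function.update_of_ne (hZ e he)]

variable [∀ i, Fintype (L i)]

/-- The expectation of `f` under the product distribution with weights `p`. -/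
noncomputable def expect (p : Element L → ℝ) (f : (∀ i, L i) → ℝ) : ℝ :=
  ∑ ω : ∀ i, L i, (∏ i, p ⟨i, ω i⟩) * f ω

variable {p : Element L → ℝ}

theorem expect_mono (hp : ∀ e, 0 ≤ p e) {f g : (∀ i, L i) → ℝ} (h : ∀ ω, f ω ≤ g ω) :
    expect p f ≤ expect p g :=
  Finset.sum_le_sum fun ω _ =>
    mul_le_mul_of_nonneg_left (h ω) (Finset.prod_nonneg fun _ _ => hp _)

theorem expect_nonneg (hp : ∀ e, 0 ≤ p e) {f : (∀ i, L i) → ℝ} (h : ∀ ω, 0 ≤ f ω) :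
    0 ≤ expect p f :=
  Finset.sum_nonneg fun ω _ => mul_nonneg (Finset.prod_nonneg fun _ _ => hp _) (h ω)

theorem expect_add (f g : (∀ i, L i) → ℝ) :
    expect p (fun ω => f ω + g ω) = expect p f + expect p g := by
  simp only [expect, mul_add, Finset.sum_add_distrib]

theorem expect_const_mul (c : ℝ) (f : (∀ i, L i) → ℝ) :
    expect p (fun ω => c * f ω) = c * expect p f := by
  simp only [expect, Finset.mul_sum]
  exact Finset.sum_congr rfl fun ω _ => by ring

theorem expect_sum {ι : Type*} (s : Finset ι) (f : ι → (∀ i, L i) → ℝ) :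
    expect p (fun ω => ∑ k ∈ s, f k ω) = ∑ k ∈ s, expect p (f k) := by
  simp only [expect, Finset.mul_sum]
  exact Finset.sum_comm

-- Independence: f ignores the coordinate of e, so splitting off that coordinate factorises the sum.
open scoped Classical in
theorem expect_occurs_singleton_mul (hp1 : ∀ i, ∑ j, p ⟨i, j⟩ = 1) (e : Element L)
    (f : (∀ i, L i) → ℝ) (hf : ∀ ω x, f (Function.update ω e.1 x) = f ω) :
    expect p (fun ω => occurs {e} ω * f ω) = p e * expect p f := by
  obtain ⟨i, j⟩ := e
  let φ := Equiv.piSplitAt i L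
  have hself : ∀ (x : L i) r, φ.symm (x, r) i = x := fun x r => by
    simp [φ, Equiv.piSplitAt]
  have hne : ∀ (x : L i) r (k : {k // k ≠ i}), φ.symm (x, r) k = r k := fun x r k => by
    simp [φ, Equiv.piSplitAt, k.2]
  have hw : ∀ (x : L i) r, ∏ k, p ⟨k, φ.symm (x, r) k⟩
      = p ⟨i, x⟩ * ∏ k : {k // k ≠ i}, p ⟨k, r k⟩ := fun x r => by
    rw [Fintype.prod_eq_mul_prod_subtype_ne _ i, hself]
    exact congrArg _ (Finset.prod_congr rfl fun k _ => by rw [hne])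
  have hfx : ∀ (x : L i) r, f (φ.symm (x, r)) = f (φ.symm (j, r)) := fun x r => by
    rw [← hf (φ.symm (j, r)) x]
    congr 1
    funext k
    by_cases hk : k = i
    · subst hk; simp [hself]
    · rw [Function.update_of_ne hk, hne x r ⟨k, hk⟩, hne j r ⟨k, hk⟩]
  have hsum : ∀ g : (∀ i, L i) → ℝ, expect p g
      = ∑ x, ∑ r, (p ⟨i, x⟩ * ∏ k : {k // k ≠ i}, p ⟨k, r k⟩) * g (φ.symm (x, r)) := fun g => by
    unfold expect
    rw [← Equiv.sum_comp φ.symm, Fintype.sum_prod_type]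
    simp only [hw]
  have hocc : ∀ (x : L i) r, occurs {(⟨i, j⟩ : Element L)} (φ.symm (x, r))
      = if x = j then 1 else 0 := fun x r => by
    simp [occurs, hself]
  rw [hsum, hsum]
  simp only [hocc, hfx, mul_assoc, ← Finset.mul_sum, ← Finset.sum_mul, hp1, one_mul]
  rw [Finset.sum_eq_single j]
  · simp
  · intro x _ hx
    simp [hx]
  · simp

theorem expect_one (hp1 : ∀ i, ∑ j, p ⟨i, j⟩ = 1) : expect p (fun _ => 1) = 1 := by
  classical
  have h := Finset.prod_univ_sum (fun i => (Finset.univ : Finset (L i))) fun i j => p ⟨i, j⟩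
  simp only [hp1, Finset.prod_const_one, Fintype.piFinset_univ] at h
  simp only [expect, mul_one]
  exact h.symm

open scoped Classical in
theorem expect_indicator_eq_measureReal [∀ i, MeasurableSpace (L i)]
    [∀ i, DiscreteMeasurableSpace (L i)] (μ : ∀ i, Measure (L i)) [∀ i, IsProbabilityMeasure (μ i)]
    (s : Set (∀ i, L i)) :
    expect (fun e => (μ e.1).real {e.2}) (s.indicator 1) = (Measure.pi μ).real s := by
  have hs : s = ((Finset.univ.filter (· ∈ s) : Finset (∀ i, L i)) : Set (∀ i, L i)) := by
    ext; simp
  conv_rhs => rw [hs]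
  rw [← sum_measureReal_singleton]
  simp only [expect, Set.indicator_apply, Pi.one_apply, mul_ite, mul_one, mul_zero,
    Finset.sum_filter, measureReal_def, Measure.pi_singleton, ENNReal.toReal_prod]

end Expectation

/-! ### Occurring weight and the relaxed avoidance indicator -/

section Avoidance

variable {N : ℕ} {L : Fin N → Type*} [∀ i, Fintype (L i)]

/-- The part of `Γ` coming from atomic events that occur in `ω` and only involve indices in `S`. -/
noncomputable def weightOn (q : AtomicEvent L → unitInterval) (S : Finset (Fin N))
    (ω : ∀ i, L i) : ℝ :=
  open scoped Classical in
  ∑ Y : AtomicEvent L with ∀ i, Y.Involves i → i ∈ S, (q Y : ℝ) * occurs Y.1 ω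

/-- The total weight of the atomic events that involve `i` and occur in `ω`. -/
noncomputable def weightAt (q : AtomicEvent L → unitInterval) (i : Fin N)
    (ω : ∀ i, L i) : ℝ :=
  open scoped Classical in
  ∑ Y : AtomicEvent L with Y.Involves i, (q Y : ℝ) * occurs Y.1 ω

theorem weightOn_nonneg (q : AtomicEvent L → unitInterval) (S : Finset (Fin N))
    (ω : ∀ i, L i) : 0 ≤ weightOn q S ω :=
  Finset.sum_nonneg fun Y _ => weight_term_nonneg q ω Y

theorem weightAt_nonneg (q : AtomicEvent L → unitInterval) (i : Fin N)
    (ω : ∀ i, L i) : 0 ≤ weightAt q i ω :=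
  Finset.sum_nonneg fun Y _ => weight_term_nonneg q ω Y

theorem weightOn_mono (q : AtomicEvent L → unitInterval) {S T : Finset (Fin N)} (h : S ⊆ T)
    (ω : ∀ i, L i) : weightOn q S ω ≤ weightOn q T ω := by
  classical
  refine Finset.sum_le_sum_of_subset_of_nonneg ?_ fun Y _ _ => weight_term_nonneg q ω Y
  intro Y hY
  simp only [Finset.mem_filter, Finset.mem_univ, true_and] at hY ⊢
  exact fun i hi => h (hY i hi)

theorem weightOn_insert_le (q : AtomicEvent L → unitInterval) (S : Finset (Fin N)) (i : Fin N)
    (ω : ∀ i, L i) : weightOn q (insert i S) ω ≤ weightOn q S ω + weightAt q i ω := by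
  classical
  unfold weightOn weightAt
  rw [← Finset.sum_union_inter]
  refine le_trans (Finset.sum_le_sum_of_subset_of_nonneg ?_
    fun Y _ _ => weight_term_nonneg q ω Y)
    (le_add_of_nonneg_right (Finset.sum_nonneg fun Y _ => weight_term_nonneg q ω Y))
  intro Y hY
  simp only [Finset.mem_union, Finset.mem_filter, Finset.mem_univ, true_and] at hY ⊢
  by_cases hi : Y.Involves i
  · exact Or.inr hi
  · refine Or.inl fun k hk => (Finset.mem_insert.1 (hY k hk)).resolve_left ?_
    rintro rfl
    exact hi hk

theorem weightOn_update (q : AtomicEvent L → unitInterval) {S : Finset (Fin N)} {i : Fin N}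
    (hi : i ∉ S) (ω : ∀ i, L i) (x : L i) :
    weightOn q S (Function.update ω i x) = weightOn q S ω := by
  classical
  refine Finset.sum_congr rfl fun Y hY => ?_
  simp only [Finset.mem_filter, Finset.mem_univ, true_and] at hY
  rw [occurs_update]
  rintro e he rfl
  exact hi (hY _ ⟨e.2, he⟩)

theorem weightOn_empty (q : AtomicEvent L → unitInterval) (hq : q AtomicEvent.empty = 0)
    (ω : ∀ i, L i) : weightOn q ∅ ω = 0 := by
  refine Finset.sum_eq_zero fun Y hY => ?_
  simp only [Finset.mem_filter, Finset.mem_univ, true_and, Finset.notMem_empty, imp_false] at hY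
  have : Y = AtomicEvent.empty :=
    Subtype.ext (Finset.eq_empty_of_forall_notMem fun e he => hY e.1 ⟨e.2, he⟩)
  rw [this, hq]
  simp

theorem one_le_weightOn_univ {q : AtomicEvent L → unitInterval} {E : Set (∀ i, L i)}
    (hq : IsFractionalHittingSet q E) {ω : ∀ i, L i} (hω : ω ∈ E) :
    1 ≤ weightOn q Finset.univ ω := by
  classical
  refine (hq _ ⟨ω, hω, rfl⟩).2.trans (le_of_eq ?_)
  have hsub : ∀ Y : AtomicEvent L, Y.1 ⊆ (assignmentOf ω).1 ↔ ∀ e ∈ Y.1, ω e.1 = e.2 := by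
    refine fun Y => forall₂_congr fun e _ => ?_
    obtain ⟨i, j⟩ := e
    simp only [assignmentOf, Finset.mem_map, Finset.mem_univ, true_and]
    constructor
    · rintro ⟨k, hk⟩
      cases hk
      rfl
    · rintro h
      exact ⟨i, by rw [← h]; rfl⟩
  simp only [weightOn, occurs, Finset.mem_univ, implies_true, Finset.filter_true, mul_ite, mul_one,
    mul_zero, Finset.sum_filter, hsub]

variable {ι : Type*}

/-- The product over `k ∈ K` of the positive parts of `1 - weightOn (Q k) S`. -/
noncomputable def slack (Q : ι → AtomicEvent L → unitInterval) (K : Finset ι)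
    (S : Finset (Fin N)) (ω : ∀ i, L i) : ℝ :=
  ∏ k ∈ K, max 0 (1 - weightOn (Q k) S ω)

theorem slack_nonneg (Q : ι → AtomicEvent L → unitInterval) (K : Finset ι)
    (S : Finset (Fin N)) (ω : ∀ i, L i) : 0 ≤ slack Q K S ω :=
  Finset.prod_nonneg fun _ _ => le_max_left _ _

theorem slack_anti (Q : ι → AtomicEvent L → unitInterval) (K : Finset ι)
    {S T : Finset (Fin N)} (h : S ⊆ T) (ω : ∀ i, L i) : slack Q K T ω ≤ slack Q K S ω :=
  Finset.prod_le_prod (fun _ _ => le_max_left _ _) fun k _ =>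
    max_le_max le_rfl (sub_le_sub_left (weightOn_mono (Q k) h ω) 1)

theorem slack_update (Q : ι → AtomicEvent L → unitInterval) (K : Finset ι)
    {S : Finset (Fin N)} {i : Fin N} (hi : i ∉ S) (ω : ∀ i, L i) (x : L i) :
    slack Q K S (Function.update ω i x) = slack Q K S ω := by
  simp only [slack, weightOn_update _ hi]

theorem slack_empty (Q : ι → AtomicEvent L → unitInterval)
    (hQ0 : ∀ k, Q k AtomicEvent.empty = 0) (K : Finset ι) (ω : ∀ i, L i) :
    slack Q K ∅ ω = 1 := by
  simp [slack, weightOn_empty _ (hQ0 _)]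

theorem slack_le_one (Q : ι → AtomicEvent L → unitInterval) (K : Finset ι)
    (S : Finset (Fin N)) (ω : ∀ i, L i) : slack Q K S ω ≤ 1 :=
  Finset.prod_le_one (fun _ _ => le_max_left _ _) fun _ _ =>
    max_le zero_le_one (sub_le_self _ (weightOn_nonneg _ _ _))

open scoped Classical in
/-- Lowering the factors `x k` to `y k ≥ x k - b k` lowers their product by at most the first-order
term. -/
theorem prod_sub_prod_le_sum {x y b : ι → ℝ} (hy : ∀ k, 0 ≤ y k) (hyx : ∀ k, y k ≤ x k)
    (hxb : ∀ k, x k - y k ≤ b k) (K : Finset ι) :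
    ∏ k ∈ K, x k - ∏ k ∈ K, y k ≤ ∑ k ∈ K, b k * ∏ l ∈ K.erase k, x l := by
  induction K using Finset.induction_on with
  | empty => simp
  | insert k K hk ih =>
    rw [Finset.prod_insert hk, Finset.prod_insert hk, Finset.sum_insert hk,
      Finset.erase_insert hk]
    have hsum : ∑ l ∈ K, b l * ∏ m ∈ (insert k K).erase l, x m
        = x k * ∑ l ∈ K, b l * ∏ m ∈ K.erase l, x m := by
      rw [Finset.mul_sum]
      refine Finset.sum_congr rfl fun l hl => ?_
      have hlk : k ≠ l := fun h => hk (h ▸ hl)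
      rw [Finset.erase_insert_of_ne hlk,
        Finset.prod_insert fun h => hk (Finset.mem_of_mem_erase h)]
      ring
    rw [hsum]
    have hXY : ∏ l ∈ K, y l ≤ ∏ l ∈ K, x l := Finset.prod_le_prod (fun l _ => hy l) fun l _ => hyx l
    have hY0 : 0 ≤ ∏ l ∈ K, y l := Finset.prod_nonneg fun l _ => hy l
    have h1 : (x k - y k) * ∏ l ∈ K, y l ≤ b k * ∏ l ∈ K, x l :=
      mul_le_mul (hxb k) hXY hY0 ((sub_nonneg.2 (hyx k)).trans (hxb k))
    have h2 := mul_le_mul_of_nonneg_left ih ((hy k).trans (hyx k))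
    linarith

-- Revealing i raises the k-th weight by at most `weightAt (Q k) i`; cutting off at 0 does not
-- increase this change, and the product loses at most the first-order term.
open scoped Classical in
theorem slack_le_slack_insert_add (Q : ι → AtomicEvent L → unitInterval) (K : Finset ι)
    (S : Finset (Fin N)) (i : Fin N) (ω : ∀ i, L i) :
    slack Q K S ω ≤ slack Q K (insert i S) ω
      + ∑ k ∈ K, weightAt (Q k) i ω * slack Q (K.erase k) S ω := by
  rw [← sub_le_iff_le_add']
  refine prod_sub_prod_le_sum (fun _ => le_max_left _ _) (fun k => ?_) (fun k => ?_) K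
  · exact max_le_max le_rfl
      (sub_le_sub_left (weightOn_mono (Q k) (Finset.subset_insert i S) ω) 1)
  · have h1 := weightOn_insert_le (Q k) S i ω
    have h2 := weightAt_nonneg (Q k) i ω
    rw [sub_le_iff_le_add']
    refine max_le (add_nonneg (le_max_left _ _) h2) ?_
    have := le_max_right 0 (1 - weightOn (Q k) (insert i S) ω)
    linarith

/-! ### The two coupled estimates and the induction -/

variable {p lam : Element L → ℝ} {κ : ℝ}

theorem GamAt_nonneg (q : AtomicEvent L → unitInterval) (hl : ∀ e, 0 ≤ lam e) (i : Fin N) :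
    0 ≤ GamAt q lam i :=
  Finset.sum_nonneg fun Y _ => mul_nonneg (q Y).2.1 (Finset.prod_nonneg fun _ _ => hl _)

-- Elements of Z are stripped one by one. If the coordinate of e lies in S, forgetting it only
-- increases the slack and makes e independent of the rest, giving p e; restoring it costs 1 + κ, in
-- total λ e.
open scoped Classical in
theorem expect_occurs_mul_slack_le (hp : ∀ e, 0 ≤ p e) (hp1 : ∀ i, ∑ j, p ⟨i, j⟩ = 1)
    (hκ : 0 ≤ κ) (hlam : ∀ e, lam e = (1 + κ) * p e)
    (Q : ι → AtomicEvent L → unitInterval) (S : Finset (Fin N))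
    (hS : ∀ T ⊂ S, ∀ i, S = insert i T → ∀ K : Finset ι,
      expect p (slack Q K T) ≤ (1 + κ) * expect p (slack Q K S))
    (ih : ∀ T ⊂ S, ∀ (Z : Finset (Element L)) (K : Finset ι),
      expect p (fun ω => occurs Z ω * slack Q K T ω)
        ≤ (∏ e ∈ Z, lam e) * expect p (slack Q K T))
    (Z : Finset (Element L)) (K : Finset ι) :
    expect p (fun ω => occurs Z ω * slack Q K S ω)
      ≤ (∏ e ∈ Z, lam e) * expect p (slack Q K S) := by
  have hl : ∀ e, 0 ≤ lam e := fun e => hlam e ▸ mul_nonneg (by linarith) (hp e)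
  have hF : ∀ T, 0 ≤ expect p (slack Q K T) := fun T => expect_nonneg hp (slack_nonneg Q K T)
  induction Z using Finset.induction_on with
  | empty => simp [occurs_empty]
  | insert e Z he ihZ =>
    rw [Finset.prod_insert he]
    have hZ0 : 0 ≤ ∏ e ∈ Z, lam e := Finset.prod_nonneg fun _ _ => hl _
    -- Two different values demanded of one coordinate never occur together, so the left side is 0.
    by_cases hcon : ∃ e' ∈ Z, e'.1 = e.1
    · obtain ⟨⟨i, j'⟩, he', hi⟩ := hcon
      obtain ⟨i, j⟩ := e
      obtain rfl : _ = i := hi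
      have h0 : ∀ ω : ∀ i, L i, occurs (insert ⟨_, j⟩ Z) ω = 0 := fun ω => by
        refine if_neg fun h => he ?_
        have h1 : ω _ = j := h _ (Finset.mem_insert_self _ _)
        have h2 : ω _ = j' := h _ (Finset.mem_insert_of_mem he')
        rwa [← h1, h2]
      simp only [h0, zero_mul]
      refine le_trans (le_of_eq (by simp [expect])) (mul_nonneg (mul_nonneg (hl _) hZ0) (hF S))
    · push Not at hcon
      have hstep : ∀ T, e.1 ∉ T → expect p (fun ω => occurs (insert e Z) ω * slack Q K T ω)
          = p e * expect p (fun ω => occurs Z ω * slack Q K T ω) := fun T hT => by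
        simp only [occurs_insert, mul_assoc]
        refine expect_occurs_singleton_mul hp1 e _ fun ω x => ?_
        rw [occurs_update hcon, slack_update Q K hT]
      by_cases heS : e.1 ∈ S
      · have hT : S.erase e.1 ⊂ S := Finset.erase_ssubset heS
        calc expect p (fun ω => occurs (insert e Z) ω * slack Q K S ω)
            ≤ expect p (fun ω => occurs (insert e Z) ω * slack Q K (S.erase e.1) ω) :=
              expect_mono hp fun ω =>
                mul_le_mul_of_nonneg_left (slack_anti Q K hT.1 ω) (occurs_nonneg _ _)
          _ = p e * expect p (fun ω => occurs Z ω * slack Q K (S.erase e.1) ω) :=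
              hstep _ (Finset.notMem_erase _ _)
          _ ≤ p e * ((∏ e ∈ Z, lam e) * ((1 + κ) * expect p (slack Q K S))) :=
              mul_le_mul_of_nonneg_left ((ih _ hT Z K).trans (mul_le_mul_of_nonneg_left
                (hS _ hT e.1 (Finset.insert_erase heS).symm K) hZ0)) (hp e)
          _ = lam e * (∏ e ∈ Z, lam e) * expect p (slack Q K S) := by rw [hlam e]; ring
      · rw [hstep S heS, mul_assoc]
        refine mul_le_mul ?_ ihZ (expect_nonneg hp fun ω =>
          mul_nonneg (occurs_nonneg _ _) (slack_nonneg _ _ _ _)) (hl e)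
        rw [hlam e]
        nlinarith [hp e]

open scoped Classical in
/-- Revealing one more coordinate lowers the expected slack by at most a factor `1 + κ`. -/
theorem expect_slack_le_insert (hp : ∀ e, 0 ≤ p e) (hp1 : ∀ i, ∑ j, p ⟨i, j⟩ = 1)
    (hκ : 0 ≤ κ) (hlam : ∀ e, lam e = (1 + κ) * p e)
    (Q : ι → AtomicEvent L → unitInterval) (hGam : ∀ k, Gam (Q k) lam < 1)
    {S : Finset (Fin N)} {i : Fin N} (hi : i ∉ S) (K : Finset ι)
    (hGamAt : ∑ k ∈ K, GamAt (Q k) lam i / (1 - Gam (Q k) lam) ≤ κ)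
    (hocc : ∀ (Z : Finset (Element L)) (K : Finset ι),
      expect p (fun ω => occurs Z ω * slack Q K S ω)
        ≤ (∏ e ∈ Z, lam e) * expect p (slack Q K S)) :
    expect p (slack Q K S) ≤ (1 + κ) * expect p (slack Q K (insert i S)) := by
  have hl : ∀ e, 0 ≤ lam e := fun e => hlam e ▸ mul_nonneg (by linarith) (hp e)
  have hF : ∀ K, 0 ≤ expect p (slack Q K S) := fun K => expect_nonneg hp (slack_nonneg Q K S)
  -- Removing one event costs a factor `1 - Γ`.
  have herase : ∀ k ∈ K, expect p (slack Q (K.erase k) S)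
      ≤ expect p (slack Q K S) / (1 - Gam (Q k) lam) := fun k hk => by
    rw [le_div_iff₀ (sub_pos.2 (hGam k))]
    -- This is 1 ≤ max(0, 1 - w) + w times the remaining product; in expectation the w-term is at
    -- most Γ times the left side.
    have hpt : ∀ ω, slack Q (K.erase k) S ω
        ≤ slack Q K S ω + weightOn (Q k) S ω * slack Q (K.erase k) S ω := fun ω => by
      have h1 : slack Q K S ω
          = max 0 (1 - weightOn (Q k) S ω) * slack Q (K.erase k) S ω :=
        (Finset.mul_prod_erase K _ hk).symm
      rw [h1, ← add_mul]
      refine le_mul_of_one_le_left (slack_nonneg _ _ _ _) ?_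
      linarith [le_max_right 0 (1 - weightOn (Q k) S ω)]
    have hw : expect p (fun ω => weightOn (Q k) S ω * slack Q (K.erase k) S ω)
        ≤ Gam (Q k) lam * expect p (slack Q (K.erase k) S) := by
      simp only [weightOn, Finset.sum_mul, mul_assoc]
      rw [expect_sum, Gam, Finset.sum_mul]
      refine le_trans (Finset.sum_le_sum fun Y _ => ?_) (Finset.sum_le_sum_of_subset_of_nonneg
        (Finset.filter_subset _ _) fun Y _ _ => ?_)
      · rw [expect_const_mul, mul_assoc]
        exact mul_le_mul_of_nonneg_left (hocc _ _) (Q k Y).2.1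
      · exact mul_nonneg (mul_nonneg (Q k Y).2.1 (Finset.prod_nonneg fun _ _ => hl _)) (hF _)
    have h := expect_mono hp hpt
    rw [expect_add] at h
    have h' : expect p (fun ω => slack Q K S ω) = expect p (slack Q K S) := rfl
    have h'' : expect p (fun ω => slack Q (K.erase k) S ω) = expect p (slack Q (K.erase k) S) := rfl
    linarith
  -- The gain of 1 + κ: as i ∉ S, the element (i, j) of Y is independent of everything else and
  -- contributes p rather than λ.
  have hat : ∀ k, expect p (fun ω => weightAt (Q k) i ω * slack Q (K.erase k) S ω) * (1 + κ)
      ≤ GamAt (Q k) lam i * expect p (slack Q (K.erase k) S) := fun k => by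
    simp only [weightAt, Finset.sum_mul, mul_assoc]
    rw [expect_sum, GamAt, Finset.sum_mul, Finset.sum_mul]
    refine Finset.sum_le_sum fun Y hY => ?_
    obtain ⟨j, hj⟩ := (Finset.mem_filter.1 hY).2
    rw [expect_const_mul, mul_assoc, mul_assoc]
    refine mul_le_mul_of_nonneg_left ?_ (Q k Y).2.1
    rw [← Finset.insert_erase hj, Finset.prod_insert (Finset.notMem_erase _ _)]
    simp only [occurs_insert, mul_assoc]
    rw [expect_occurs_singleton_mul hp1 ⟨i, j⟩, hlam ⟨i, j⟩]
    · have h := mul_le_mul_of_nonneg_left (hocc (Y.1.erase ⟨i, j⟩) (K.erase k))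
        (hl ⟨i, j⟩)
      rw [hlam ⟨i, j⟩] at h
      linarith
    · intro ω x
      rw [slack_update Q _ hi, occurs_update]
      rintro ⟨i', j'⟩ he rfl
      obtain ⟨hne, hmem⟩ := Finset.mem_erase.1 he
      exact hne (by rw [Y.2 _ _ _ hj hmem])
  have h := expect_mono hp (slack_le_slack_insert_add Q K S i)
  rw [expect_add, expect_sum] at h
  -- The loss is thus at most κ / (1 + κ) of the old expectation, which leaves at least the fraction
  -- 1 / (1 + κ).
  have hloss : (∑ k ∈ K, expect p (fun ω => weightAt (Q k) i ω * slack Q (K.erase k) S ω))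
      * (1 + κ) ≤ κ * expect p (slack Q K S) := by
    rw [Finset.sum_mul]
    refine le_trans (Finset.sum_le_sum fun k hk => (hat k).trans
      (mul_le_mul_of_nonneg_left (herase k hk) (GamAt_nonneg _ hl i))) ?_
    refine le_trans (le_of_eq ?_) (mul_le_mul_of_nonneg_right hGamAt (hF K))
    rw [Finset.sum_mul]
    exact Finset.sum_congr rfl fun k _ => by ring
  have h' : expect p (fun ω => slack Q K S ω) ≤ expect p (slack Q K (insert i S))
      + ∑ k ∈ K, expect p (fun ω => weightAt (Q k) i ω * slack Q (K.erase k) S ω) := h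
  have h'' := mul_le_mul_of_nonneg_right h' (by linarith : (0 : ℝ) ≤ 1 + κ)
  have h3 : expect p (fun ω => slack Q K S ω) = expect p (slack Q K S) := rfl
  rw [h3] at h''
  linarith

theorem expect_slack_step (hp : ∀ e, 0 ≤ p e) (hp1 : ∀ i, ∑ j, p ⟨i, j⟩ = 1)
    (hκ : 0 ≤ κ) (hlam : ∀ e, lam e = (1 + κ) * p e)
    (Q : ι → AtomicEvent L → unitInterval) (hGam : ∀ k, Gam (Q k) lam < 1)
    (hGamAt : ∀ i, ∀ K : Finset ι, ∑ k ∈ K, GamAt (Q k) lam i / (1 - Gam (Q k) lam) ≤ κ)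
    {S : Finset (Fin N)} {i : Fin N} (hi : i ∉ S) (K : Finset ι) :
    expect p (slack Q K S) ≤ (1 + κ) * expect p (slack Q K (insert i S)) := by
  refine expect_slack_le_insert hp hp1 hκ hlam Q hGam hi K (hGamAt i K) ?_
  -- Estimate (A) does not mention i, so the induction runs over all S, including sets containing i.
  clear hi
  induction S using Finset.strongInduction with
  | H S ih =>
    refine expect_occurs_mul_slack_le hp hp1 hκ hlam Q S (fun T hT i hS K => ?_) ih
    subst hS
    refine expect_slack_le_insert hp hp1 hκ hlam Q hGam (fun hi => ?_) K (hGamAt i K) (ih T hT)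
    exact hT.2 (by simp [Finset.insert_eq_self.2 hi])

theorem one_le_pow_mul_expect_slack (hp : ∀ e, 0 ≤ p e) (hp1 : ∀ i, ∑ j, p ⟨i, j⟩ = 1)
    (hκ : 0 ≤ κ) (hlam : ∀ e, lam e = (1 + κ) * p e)
    (Q : ι → AtomicEvent L → unitInterval) (hQ0 : ∀ k, Q k AtomicEvent.empty = 0)
    (hGam : ∀ k, Gam (Q k) lam < 1)
    (hGamAt : ∀ i, ∀ K : Finset ι, ∑ k ∈ K, GamAt (Q k) lam i / (1 - Gam (Q k) lam) ≤ κ)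
    (K : Finset ι) (S : Finset (Fin N)) :
    1 ≤ (1 + κ) ^ S.card * expect p (slack Q K S) := by
  induction S using Finset.induction_on with
  | empty =>
    have : slack Q K ∅ = fun _ => 1 := funext (slack_empty Q hQ0 K)
    rw [this, expect_one hp1]
    simp
  | insert i S hi ih =>
    rw [Finset.card_insert_of_notMem hi, pow_succ, mul_assoc]
    exact ih.trans (mul_le_mul_of_nonneg_left
      (expect_slack_step hp hp1 hκ hlam Q hGam hGamAt hi K) (by positivity))

end Avoidance

end PartialResampling

/-! ### From expected slack to the avoidance probability -/

theorem corollary4p6 {N K : ℕ} {L : Fin N → Type*} [∀ i, Fintype (L i)]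
    [∀ i, MeasurableSpace (L i)] [∀ i, DiscreteMeasurableSpace (L i)]
    (μ : ∀ i, Measure (L i)) [∀ i, IsProbabilityMeasure (μ i)]
    (E : Fin K → Set (∀ i, L i))
    (κ : ℝ) (hκ0 : 0 < κ) (hκ1 : κ < 1)
    (lam : PartialResampling.Element L → ℝ)
    (hlam : ∀ (i : Fin N) (j : L i), lam ⟨i, j⟩ = (1 + κ) * (μ i).real {j})
    (Q : Fin K → PartialResampling.AtomicEvent L → unitInterval)
    (hQ : ∀ k, PartialResampling.IsFractionalHittingSet (Q k) (E k))
    (hGam : ∀ k, PartialResampling.Gam (Q k) lam < 1)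
    (hGamAt : ∀ i : Fin N,
      ∑ k, PartialResampling.GamAt (Q k) lam i / (1 - PartialResampling.Gam (Q k) lam) ≤ κ / 2) :
    κ / 3 * (1 + κ) ^ (-(N : ℤ)) ≤ (Measure.pi μ).real (⋂ k, (E k)ᶜ) := by
  classical
  let p : PartialResampling.Element L → ℝ := fun e => (μ e.1).real {e.2}
  have hp : ∀ e, 0 ≤ p e := fun e => measureReal_nonneg
  have hp1 : ∀ i, ∑ j, p ⟨i, j⟩ = 1 := fun i => by
    have h := sum_measureReal_singleton (μ := μ i) Finset.univ
    rwa [Finset.coe_univ, probReal_univ] at h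
  have hl : ∀ e, 0 ≤ lam e := fun e => by
    rw [show lam e = _ from hlam e.1 e.2]
    exact mul_nonneg (by linarith) (hp e)
  -- Empty events are discarded, as their hitting sets may charge the empty atomic event.
  let Q' : {k // (E k).Nonempty} → PartialResampling.AtomicEvent L → unitInterval := fun k => Q k
  have hQ0 : ∀ k, Q' k PartialResampling.AtomicEvent.empty = 0 := fun k =>
    (hQ k _ ⟨_, k.2.some_mem, rfl⟩).1
  have hGamAt' : ∀ i, ∀ K' : Finset {k // (E k).Nonempty},
      ∑ k ∈ K', PartialResampling.GamAt (Q' k) lam i / (1 - PartialResampling.Gam (Q' k) lam)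
        ≤ κ := fun i K' => by
    have hnn : ∀ k, 0 ≤ PartialResampling.GamAt (Q k) lam i
        / (1 - PartialResampling.Gam (Q k) lam) := fun k =>
      div_nonneg (PartialResampling.GamAt_nonneg _ hl i) (sub_pos.2 (hGam k)).le
    calc _ = ∑ k ∈ K'.map (Function.Embedding.subtype _),
          PartialResampling.GamAt (Q k) lam i / (1 - PartialResampling.Gam (Q k) lam) := by
          rw [Finset.sum_map]; rfl
      _ ≤ _ := Finset.sum_le_sum_of_subset_of_nonneg (Finset.subset_univ _) fun k _ _ => hnn k
      _ ≤ κ := (hGamAt i).trans (by linarith)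
  have hmain := PartialResampling.one_le_pow_mul_expect_slack hp hp1 hκ0.le
    (fun e => hlam e.1 e.2) Q' hQ0 (fun k => hGam k) hGamAt' Finset.univ Finset.univ
  have hle : PartialResampling.expect p (PartialResampling.slack Q' Finset.univ Finset.univ)
      ≤ (Measure.pi μ).real (⋂ k, (E k)ᶜ) := by
    rw [← PartialResampling.expect_indicator_eq_measureReal]
    refine PartialResampling.expect_mono hp fun ω => ?_
    by_cases hω : ω ∈ ⋂ k, (E k)ᶜ
    · rw [Set.indicator_of_mem hω]
      exact PartialResampling.slack_le_one _ _ _ _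
    · rw [Set.indicator_of_notMem hω]
      simp only [Set.mem_iInter, Set.mem_compl_iff, not_forall, not_not] at hω
      obtain ⟨k, hk⟩ := hω
      refine le_of_eq (Finset.prod_eq_zero (Finset.mem_univ ⟨k, ω, hk⟩) (max_eq_left ?_))
      exact sub_nonpos.2 (PartialResampling.one_le_weightOn_univ (hQ k) hk)
  rw [Finset.card_univ, Fintype.card_fin] at hmain
  have hpow : 0 < (1 + κ) ^ N := by positivity
  -- The argument gives (1 + κ)^(-N) outright; the factor κ / 3 is below 1 and is given away.
  rw [zpow_neg, zpow_natCast, ← div_eq_mul_inv, div_le_iff₀ hpow]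
  have := mul_le_mul_of_nonneg_left hle hpow.le
  linarith
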